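/- Let $n\ge 0$ and let $N$ be a compact topological $n$-manifold with (possibly empty) boundary, with manifold interior ${\rm int}(N)$ (the points having an open neighbourhood homeomorphic to an open subset of $\mathbb{R}^n$) and manifold boundary $\partial N=N\setminus{\rm int}(N)$. Let $K\subset{\rm int}(N)$ be a topological spine of $N$, i.e. a compact set such that $N\setminus K$ is homeomorphic to $\partial N\times[0,+\infty)$. Then the inclusion $i:K\hookrightarrow N$ is a shape equivalence: it induces an isomorphism in the shape category, whose morphisms $X\to Y$ are the natural transformations $[Y,-]\to[X,-]$ between the functors of homotopy classes of maps into (metrizable) absolute neighbourhood retracts. -/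

import Mathlib

universe u v w

/-! ### Topological manifolds with boundary -/

/-- The closed half-space `{x ∈ ℝⁿ : 0 ≤ x₀}`; for `n = 0` there is no condition, so that it is
the one-point space `ℝ⁰`. -/
abbrev ClosedHalfSpace (n : ℕ) : Type :=
  {x : EuclideanSpace ℝ (Fin n) // ∀ i : Fin n, (i : ℕ) = 0 → 0 ≤ x i}

/-- `N` is a topological `n`-manifold with (possibly empty) boundary: Hausdorff, second countable,
and each point has an open neighbourhood homeomorphic to an open subset of the half-space. -/
structure IsManifoldWithBoundary (n : ℕ) (N : Type u) [TopologicalSpace N] : Prop where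
  t2 : T2Space N
  secondCountable : SecondCountableTopology N
  exists_chart : ∀ x : N, ∃ φ : OpenPartialHomeomorph N (ClosedHalfSpace n), x ∈ φ.source

/-- The manifold interior `int N`: the points having an open neighbourhood homeomorphic to an open
subset of `ℝⁿ`. -/
def manifoldInterior (n : ℕ) (N : Type u) [TopologicalSpace N] : Set N :=
  {x | ∃ φ : OpenPartialHomeomorph N (EuclideanSpace ℝ (Fin n)), x ∈ φ.source}

/-- The manifold boundary `∂N`: the points that are not interior points. -/
def manifoldBoundary (n : ℕ) (N : Type u) [TopologicalSpace N] : Set N :=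
  (manifoldInterior n N)ᶜ

/-- `K` is a topological spine of the `n`-manifold with boundary `N`: it is a compact subset of
`int N` and `N \ K` is homeomorphic to `∂N × [0, +∞)`. -/
structure IsTopologicalSpine (n : ℕ) {N : Type u} [TopologicalSpace N] (K : Set N) : Prop where
  isCompact : IsCompact K
  subset_interior : K ⊆ manifoldInterior n N
  homeomorphic : Nonempty (↥Kᶜ ≃ₜ ↥(manifoldBoundary n N) × ↥(Set.Ici (0 : ℝ)))

/-! ### Absolute neighbourhood retracts -/

/-- `P` is an absolute neighbourhood retract (for metrizable spaces): it is metrizable and, whenever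
it is embedded as a closed subset of a metrizable space `Z`, it is a retract of an open
neighbourhood of its image in `Z`. -/
structure IsANR (P : Type u) [TopologicalSpace P] : Prop where
  metrizable : TopologicalSpace.MetrizableSpace P
  exists_retraction : ∀ (Z : Type u) [TopologicalSpace Z] [TopologicalSpace.MetrizableSpace Z]
    (e : P → Z), Topology.IsClosedEmbedding e →
      ∃ U : Set Z, IsOpen U ∧ Set.range e ⊆ U ∧
        ∃ r : C(↥U, P), ∀ (p : P) (hp : e p ∈ U), r ⟨e p, hp⟩ = p

/-! ### Homotopy classes of maps -/

/-- The set `[X, P]` of homotopy classes of continuous maps `X → P`. -/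
def HomotopyClasses (X : Type u) (P : Type v) [TopologicalSpace X] [TopologicalSpace P] :
    Type (max u v) :=
  Quotient (⟨ContinuousMap.Homotopic, ContinuousMap.Homotopic.equivalence⟩ : Setoid C(X, P))

namespace HomotopyClasses

/-- The map `[X, P] → [X, Q]` induced by composition with `g : P → Q`. -/
def postcomp {X : Type u} {P : Type v} {Q : Type w} [TopologicalSpace X] [TopologicalSpace P]
    [TopologicalSpace Q] (g : C(P, Q)) : HomotopyClasses X P → HomotopyClasses X Q :=
  Quotient.map (fun f : C(X, P) => g.comp f)
    (fun _ _ h => ContinuousMap.Homotopic.comp (ContinuousMap.Homotopic.refl g) h)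

/-- The map `[Y, P] → [X, P]` induced by composition with `f : X → Y`. -/
def precomp {X : Type u} {Y : Type v} {P : Type w} [TopologicalSpace X] [TopologicalSpace Y]
    [TopologicalSpace P] (f : C(X, Y)) : HomotopyClasses Y P → HomotopyClasses X P :=
  Quotient.map (fun g : C(Y, P) => g.comp f)
    (fun _ _ h => ContinuousMap.Homotopic.comp h (ContinuousMap.Homotopic.refl f))

end HomotopyClasses

/-! ### The shape category -/

/-- A shape morphism `X → Y`: a natural transformation from the functor `[Y, -]` to the functor
`[X, -]`, both on the homotopy category of absolute neighbourhood retracts. -/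
@[ext]
structure ShapeMorphism (X Y : Type u) [TopologicalSpace X] [TopologicalSpace Y] where
  app : ∀ (P : Type u) [TopologicalSpace P], IsANR P → HomotopyClasses Y P → HomotopyClasses X P
  naturality : ∀ (P Q : Type u) [TopologicalSpace P] [TopologicalSpace Q] (hP : IsANR P)
    (hQ : IsANR Q) (g : C(P, Q)) (a : HomotopyClasses Y P),
      app Q hQ (HomotopyClasses.postcomp g a) = HomotopyClasses.postcomp g (app P hP a)

namespace ShapeMorphism

/-- The identity shape morphism. -/
def id (X : Type u) [TopologicalSpace X] : ShapeMorphism X X where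
  app _ _ _ a := a
  naturality _ _ _ _ _ _ _ _ := rfl

/-- The composite `X → Y → Z` of the shape morphisms `F : X → Y` and `G : Y → Z`. -/
def comp {X Y Z : Type u} [TopologicalSpace X] [TopologicalSpace Y] [TopologicalSpace Z]
    (G : ShapeMorphism Y Z) (F : ShapeMorphism X Y) : ShapeMorphism X Z where
  app P _ hP a := F.app P hP (G.app P hP a)
  naturality P Q _ _ hP hQ g a := by rw [G.naturality P Q hP hQ, F.naturality P Q hP hQ]

/-- The shape morphism induced by a continuous map. -/
def ofMap {X Y : Type u} [TopologicalSpace X] [TopologicalSpace Y] (f : C(X, Y)) :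
    ShapeMorphism X Y where
  app _ _ _ a := HomotopyClasses.precomp f a
  naturality _ _ _ _ _ _ _ a := Quotient.inductionOn a fun _ => rfl

end ShapeMorphism

/-- A continuous map is a shape equivalence if the shape morphism that it induces is an
isomorphism of the shape category. -/
def IsShapeEquivalence {X Y : Type u} [TopologicalSpace X] [TopologicalSpace Y] (f : C(X, Y)) :
    Prop :=
  ∃ G : ShapeMorphism Y X,
    G.comp (ShapeMorphism.ofMap f) = ShapeMorphism.id X ∧
      (ShapeMorphism.ofMap f).comp G = ShapeMorphism.id Y

/-! It suffices that restriction `[N, P] → [K, P]` is bijective for each ANR `P`; the inverses are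
then automatically natural. Two facts carry this. A map into `P` from a compact subset of a metric
space extends over a neighbourhood: embed `P` in a Banach space, extend there by Dugundji averaging,
and retract. And `N` deforms rel `K` into any neighbourhood of `K`, by pushing outwards along the
half-line coordinate of `N \ K`. Surjectivity: extend `f` over a neighbourhood `V` of `K` and
precompose with the end of a deformation into `V`. Injectivity: extend from `{0, 1} × N ∪ I × K` a
homotopy given on `K`, then deform `N` into a `V` so small that the extension is defined on `I × V`.
-/

section

open Set Topology Filter unitInterval

/-! ### Extension of maps from compact sets -/

/-- A map from a compact subset of a metric space to a Banach space extends continuously to the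
whole space. -/
theorem exists_continuous_extension_of_isCompact {X : Type v} {E : Type w} [MetricSpace X]
    [NormedAddCommGroup E] [NormedSpace ℝ E] [CompleteSpace E] {A : Set X} (hA : IsCompact A)
    {f : X → E} (hf : ContinuousOn f A) : ∃ F : X → E, Continuous F ∧ EqOn F f A := by
  classical
  rcases A.eq_empty_or_nonempty with rfl | hne
  · exact ⟨fun _ => 0, continuous_const, eqOn_empty _ _⟩
  have : CompactSpace A := isCompact_iff_compactSpace.1 hA
  have : Nonempty A := hne.to_subtype
  obtain ⟨a, ha⟩ := TopologicalSpace.exists_dense_seq A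
  obtain ⟨M, hM⟩ := hA.exists_bound_of_continuousOn hf
  have hpos : ∀ x ∉ A, 0 < Metric.infDist x A := fun x hx =>
    (hA.isClosed.notMem_iff_infDist_pos hne).1 hx
  -- Off `A`, the weight of `a n` is nonzero only if `a n` is less than twice as far from `x` as `A`
  -- is; the factor `(1/2)^n` makes the series converge uniformly.
  let w : ℕ → X → ℝ := fun n x => (1 / 2 : ℝ) ^ n * max 0 (2 - dist x (a n) / Metric.infDist x A)
  have hw0 : ∀ n x, 0 ≤ w n x := fun n x => by positivity
  have hw2 : ∀ n x, w n x ≤ (1 / 2 : ℝ) ^ n * 2 := fun n x => by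
    have : 0 ≤ dist x (a n) / Metric.infDist x A := div_nonneg dist_nonneg Metric.infDist_nonneg
    exact mul_le_mul_of_nonneg_left (max_le (by norm_num) (by linarith)) (by positivity)
  have hsum2 : Summable fun n : ℕ => (1 / 2 : ℝ) ^ n * 2 := summable_geometric_two.mul_right 2
  have hsw : ∀ x, Summable fun n => w n x := fun x =>
    Summable.of_nonneg_of_le (fun n => hw0 n x) (fun n => hw2 n x) hsum2
  have hwnorm : ∀ n x, ‖w n x‖ ≤ (1 / 2 : ℝ) ^ n * 2 := fun n x => by
    rw [Real.norm_of_nonneg (hw0 n x)]; exact hw2 n x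
  have hwfnorm : ∀ n x, ‖w n x • f (a n)‖ ≤ (1 / 2 : ℝ) ^ n * 2 * M := fun n x => by
    rw [norm_smul]
    exact mul_le_mul (hwnorm n x) (hM _ (a n).2) (norm_nonneg _) (by positivity)
  have hswf : ∀ x, Summable fun n => w n x • f (a n) := fun x =>
    Summable.of_norm_bounded (hsum2.mul_right M) (fun n => hwfnorm n x)
  have hwc : ∀ n, ContinuousOn (w n) Aᶜ := fun n => by
    refine continuousOn_const.mul (continuousOn_const.sup (continuousOn_const.sub ?_))
    exact ContinuousOn.div (by fun_prop) (Metric.continuous_infDist_pt A).continuousOn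
      fun x hx => (hpos x hx).ne'
  have hspos : ∀ x ∉ A, 0 < ∑' n, w n x := fun x hx => by
    obtain ⟨y, hy, hxy⟩ := (Metric.infDist_lt_iff (r := 2 * Metric.infDist x A) hne).1
      (by linarith [hpos x hx])
    obtain ⟨n, hn⟩ := ha.exists_mem_open
      (s := {z : A | dist x z < 2 * Metric.infDist x A}) (isOpen_lt (by fun_prop) (by fun_prop))
      ⟨⟨y, hy⟩, hxy⟩
    refine (hsw x).tsum_pos (fun n => hw0 n x) n (mul_pos (by positivity) (lt_max_of_lt_right ?_))
    rw [sub_pos, div_lt_iff₀ (hpos x hx)]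
    exact hn
  refine ⟨fun x => if x ∈ A then f x else (∑' n, w n x)⁻¹ • ∑' n, w n x • f (a n), ?_,
    fun x hx => if_pos hx⟩
  refine continuous_iff_continuousAt.2 fun x => ?_
  by_cases hx : x ∈ A
  · rw [Metric.continuousAt_iff]
    intro ε hε
    obtain ⟨δ, hδ, h⟩ := Metric.continuousOn_iff.1 hf x hx (ε / 2) (half_pos hε)
    -- If `w n y ≠ 0` then `dist y (a n) < 2 * dist y x`, so `a n` lies within `3 * dist y x < δ` of
    -- `x`.
    refine ⟨δ / 3, by positivity, fun y hy => ?_⟩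
    simp only [if_pos hx]
    split_ifs with hyA
    · linarith [h y hyA (by linarith)]
    · have hS := hspos y hyA
      have hterm : ∀ n, ‖w n y • (f (a n) - f x)‖ ≤ w n y * (ε / 2) := fun n => by
        rw [norm_smul, Real.norm_of_nonneg (hw0 n y)]
        by_cases hlt : dist y (a n) < 2 * Metric.infDist y A
        · refine mul_le_mul_of_nonneg_left ?_ (hw0 n y)
          rw [← dist_eq_norm]
          refine (h _ (a n).2 ?_).le
          have h1 := Metric.infDist_le_dist_of_mem (x := y) hx
          have h2 := dist_triangle_left (a n : X) x y
          linarith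
        · have : w n y = 0 := by
            have : 2 - dist y (a n) / Metric.infDist y A ≤ 0 := by
              rw [sub_nonpos, le_div_iff₀ (hpos y hyA)]
              exact not_lt.1 hlt
            simp only [w, max_eq_left this, mul_zero]
          simp [this]
      have hdiff : (∑' n, w n y)⁻¹ • ∑' n, w n y • f (a n) - f x
          = (∑' n, w n y)⁻¹ • ∑' n, w n y • (f (a n) - f x) := by
        simp only [smul_sub]
        rw [(hswf y).tsum_sub ((hsw y).smul_const _), (hsw y).tsum_smul_const, smul_sub,
          inv_smul_smul₀ hS.ne']
      rw [dist_eq_norm, hdiff, norm_smul, norm_inv, Real.norm_of_nonneg hS.le]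
      have hb := tsum_of_norm_bounded ((hsw y).mul_right (ε / 2)).hasSum hterm
      rw [tsum_mul_right] at hb
      calc (∑' n, w n y)⁻¹ * ‖∑' n, w n y • (f (a n) - f x)‖
          ≤ (∑' n, w n y)⁻¹ * ((∑' n, w n y) * (ε / 2)) :=
            mul_le_mul_of_nonneg_left hb (by positivity)
        _ = ε / 2 := inv_mul_cancel_left₀ hS.ne' _
        _ < ε := half_lt_self hε
  · have hcont : ContinuousOn (fun x => (∑' n, w n x)⁻¹ • ∑' n, w n x • f (a n)) Aᶜ :=
      ((continuousOn_tsum hwc hsum2 fun n x _ => hwnorm n x).inv₀ fun x hx => (hspos x hx).ne').smul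
        (continuousOn_tsum (fun n => (hwc n).smul continuousOn_const) (hsum2.mul_right M)
          fun n x _ => hwfnorm n x)
    refine (hcont.congr fun y hy => if_neg hy).continuousAt (hA.isClosed.isOpen_compl.mem_nhds hx)

/-- The Kuratowski embedding: every metric space embeds isometrically into the Banach space of its
bounded continuous real functions. -/
theorem exists_isometry_boundedContinuousFunction (P : Type u) [MetricSpace P] :
    ∃ e : P → BoundedContinuousFunction P ℝ, Isometry e := by
  rcases isEmpty_or_nonempty P with _ | ⟨⟨p₀⟩⟩
  · exact ⟨fun _ => 0, isometry_subsingleton⟩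
  refine ⟨fun p => BoundedContinuousFunction.ofNormedAddCommGroup
    (fun q => dist p q - dist p₀ q) (by fun_prop) (dist p p₀)
    (fun q => abs_dist_sub_le p p₀ q), Isometry.of_dist_eq fun p q => le_antisymm ?_ ?_⟩
  · refine (BoundedContinuousFunction.dist_le dist_nonneg).2 fun r => ?_
    simpa [Real.dist_eq] using abs_dist_sub_le p q r
  · refine le_trans ?_ (BoundedContinuousFunction.dist_coe_le_dist q)
    simp

/-- A map from a compact subset of a metric space to an absolute neighbourhood retract extends
continuously to an open neighbourhood. -/
theorem IsANR.exists_extension {P : Type u} [TopologicalSpace P] (hP : IsANR P) {X : Type v}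
    [MetricSpace X] {A : Set X} (hA : IsCompact A) {f : X → P} (hf : ContinuousOn f A) :
    ∃ U : Set X, IsOpen U ∧ A ⊆ U ∧ ∃ g : X → P, ContinuousOn g U ∧ EqOn g f A := by
  classical
  have := hP.metrizable
  let _ : MetricSpace P := TopologicalSpace.metrizableSpaceMetric P
  rcases A.eq_empty_or_nonempty with rfl | hne
  · exact ⟨∅, isOpen_empty, subset_rfl, f, continuousOn_empty _, eqOn_empty _ _⟩
  obtain ⟨k, hk⟩ := exists_isometry_boundedContinuousFunction P
  obtain ⟨F, hF, hFk⟩ := exists_continuous_extension_of_isCompact hA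
    (hk.continuous.comp_continuousOn hf)
  -- The image of `k` need not be closed in the Banach space. In `S` it is the whole slice at height
  -- zero, hence closed.
  let S : Set (BoundedContinuousFunction P ℝ × ℝ) := {z | z.2 = 0 → z.1 ∈ range k}
  let e : P → S := fun p => ⟨(k p, 0), fun _ => mem_range_self p⟩
  have hrange : range e = {z : S | z.1.2 = 0} := by
    ext z
    constructor
    · rintro ⟨p, rfl⟩; rfl
    · intro hz
      obtain ⟨p, hp⟩ := z.2 hz
      exact ⟨p, Subtype.ext (Prod.ext hp hz.symm)⟩
  have he : IsClosedEmbedding e := by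
    refine ⟨?_, ?_⟩
    · refine (Isometry.of_dist_eq fun p q => ?_).isEmbedding
      simp [e, Subtype.dist_eq, Prod.dist_eq, hk.dist_eq]
    · rw [hrange]
      exact isClosed_eq (by fun_prop) continuous_const
  obtain ⟨V, hV, heV, r, hr⟩ := hP.exists_retraction S e he
  -- The height `infDist x A` vanishes only on `A`, where `F` takes values in the image of `k`; so
  -- `G` lands in `S`.
  let G : X → S := fun x => ⟨(F x, Metric.infDist x A), fun h0 => by
    have hx : x ∈ A := (hA.isClosed.mem_iff_infDist_zero hne).2 h0
    exact ⟨f x, (hFk hx).symm⟩⟩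
  have hG : Continuous G :=
    (hF.prodMk (Metric.continuous_infDist_pt A)).subtype_mk _
  have hGe : ∀ x ∈ A, G x = e (f x) := fun x hx =>
    Subtype.ext (Prod.ext (hFk hx) ((hA.isClosed.mem_iff_infDist_zero hne).1 hx))
  have hGV : ∀ x ∈ A, G x ∈ V := fun x hx => by rw [hGe x hx]; exact heV (mem_range_self _)
  refine ⟨G ⁻¹' V, hV.preimage hG, hGV, fun x => if h : G x ∈ V then r ⟨G x, h⟩ else f x, ?_, ?_⟩
  · rw [continuousOn_iff_continuous_domRestrict]
    have : Continuous fun x : G ⁻¹' V => r ⟨G x, x.2⟩ :=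
      r.continuous.comp ((hG.comp continuous_subtype_val).subtype_mk _)
    refine this.congr fun x => ?_
    have hx : G x ∈ V := x.2
    simp [hx]
  · intro x hx
    have h := hGV x hx
    simp only [dif_pos h]
    have h' : e (f x) ∈ V := heV (mem_range_self _)
    rw [← hr (f x) h']
    congr 2
    exact hGe x hx

/-! ### Deformation towards the spine -/

/-- If the complement of a compact set `K` in a compact Hausdorff space is a product of a compact
space with a half-line, then the whole space deforms, relative to `K`, into any neighbourhood
of `K`. -/
theorem exists_deformation_into_nhds {N : Type u} {B : Type v} [TopologicalSpace N] [CompactSpace N]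
    [T2Space N] [TopologicalSpace B] [CompactSpace B] {K : Set N} (hK : IsCompact K)
    (h : ↥Kᶜ ≃ₜ B × ↥(Ici (0 : ℝ))) {V : Set N} (hV : IsOpen V) (hKV : K ⊆ V) :
    ∃ H : I × N → N, Continuous H ∧ (∀ x, H (0, x) = x) ∧ (∀ t, ∀ x ∈ K, H (t, x) = x) ∧
      ∀ x, H (1, x) ∈ V := by
  classical
  -- The complement of `V` is compact and misses `K`, so the half-line coordinate is bounded on it.
  obtain ⟨R, hR0, hR⟩ : ∃ R : ℝ, 0 ≤ R ∧ ∀ z : ↥Kᶜ, R ≤ (h z).2 → (z : N) ∈ V := by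
    have hc : IsCompact ((fun z : ↥Kᶜ => ((h z).2 : ℝ)) '' (Subtype.val ⁻¹' Vᶜ)) := by
      refine IsCompact.image ?_ (by fun_prop)
      rw [Subtype.isCompact_iff, Subtype.image_preimage_coe,
        inter_eq_right.2 (compl_subset_compl.2 hKV)]
      exact hV.isClosed_compl.isCompact
    obtain ⟨R, hR⟩ := hc.bddAbove
    refine ⟨max R 0 + 1, by positivity, fun z hz => by_contra fun hzV => ?_⟩
    have h1 : ((h z).2 : ℝ) ≤ R := hR ⟨z, hzV, rfl⟩
    linarith [le_max_left R 0]
  -- At time `t` the half-line coordinate is raised to at least `t * R`.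
  let H : I × N → N := fun p => if hp : p.2 ∈ K then p.2 else
    h.symm ((h ⟨p.2, hp⟩).1, ⟨max ((h ⟨p.2, hp⟩).2 : ℝ) (p.1 * R),
      mem_Ici.2 (le_max_of_le_left (h ⟨p.2, hp⟩).2.2)⟩)
  have hHK : ∀ t, ∀ x ∈ K, H (t, x) = x := fun t x hx => dif_pos hx
  have hHfix : ∀ (t : I) (z : ↥Kᶜ), t * R ≤ (h z).2 → H (t, z) = z := fun t z hz => by
    simp only [H, dif_neg z.2]
    have : (⟨max ((h z).2 : ℝ) (t * R), mem_Ici.2 (le_max_of_le_left (h z).2.2)⟩ : Ici (0 : ℝ)) = (h z).2 :=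
      Subtype.ext (max_eq_left hz)
    rw [this, Prod.mk.eta, h.symm_apply_apply]
  -- This set is a copy of `B × [0, R]`, hence compact. Its complement is a neighbourhood of `K` on
  -- which `H` is stationary, which gives continuity at points of `K`.
  have hclosed : IsClosed (Subtype.val '' {z : ↥Kᶜ | ((h z).2 : ℝ) ≤ R}) := by
    have : {z : ↥Kᶜ | ((h z).2 : ℝ) ≤ R} = h.symm '' (univ ×ˢ (Subtype.val ⁻¹' Icc 0 R)) := by
      ext z
      rw [h.symm.image_eq_preimage_symm]
      have := mem_Ici.1 (h z).2.2
      simp [this]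
    rw [this]
    refine (((isCompact_univ.prod ?_).image h.symm.continuous).image
      continuous_subtype_val).isClosed
    rw [Subtype.isCompact_iff, Subtype.image_preimage_coe, inter_eq_right.2 fun x hx => hx.1]
    exact isCompact_Icc
  refine ⟨H, continuous_iff_continuousAt.2 fun ⟨t, x⟩ => ?_, fun x => ?_, hHK, fun x => ?_⟩
  · by_cases hx : x ∈ K
    · refine continuousAt_snd.congr ?_
      have hmem : x ∈ (Subtype.val '' {z : ↥Kᶜ | ((h z).2 : ℝ) ≤ R})ᶜ := by
        rintro ⟨z, -, rfl⟩
        exact z.2 hx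
      filter_upwards [continuousAt_snd.preimage_mem_nhds (hclosed.isOpen_compl.mem_nhds hmem)]
      rintro ⟨s, y⟩ hy
      by_cases hyK : y ∈ K
      · exact (hHK s y hyK).symm
      · refine (hHfix s ⟨y, hyK⟩ ?_).symm
        have : R < (h ⟨y, hyK⟩).2 := not_le.1 fun hle => hy ⟨_, hle, rfl⟩
        nlinarith [s.2.1, s.2.2]
    · have hopen : IsOpen ((univ : Set I) ×ˢ Kᶜ) := isOpen_univ.prod hK.isClosed.isOpen_compl
      refine ContinuousOn.continuousAt ?_ (hopen.mem_nhds ⟨mem_univ t, hx⟩)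
      rw [continuousOn_iff_continuous_domRestrict]
      have hi : Continuous fun p : ↥((univ : Set I) ×ˢ Kᶜ) => (⟨p.1.2, p.2.2⟩ : ↥Kᶜ) := by fun_prop
      have : Continuous fun p : ↥((univ : Set I) ×ˢ Kᶜ) => ((h.symm ((h ⟨p.1.2, p.2.2⟩).1,
          ⟨max ((h ⟨p.1.2, p.2.2⟩).2 : ℝ) (p.1.1 * R),
            mem_Ici.2 (le_max_of_le_left (h ⟨p.1.2, p.2.2⟩).2.2)⟩) : ↥Kᶜ) : N) := by
        fun_prop
      refine this.congr fun p => ?_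
      have hp : p.1.2 ∉ K := p.2.2
      simp [H, hp]
  · by_cases hx : x ∈ K
    · exact hHK 0 x hx
    · exact hHfix 0 ⟨x, hx⟩ (by simpa using mem_Ici.1 (h ⟨x, hx⟩).2.2)
  · by_cases hx : x ∈ K
    · rw [hHK 1 x hx]
      exact hKV hx
    · simp only [H, dif_neg hx]
      exact hR _ (by simp)

/-! ### From deformations to shape equivalence -/

/-- A continuous map is a shape equivalence as soon as precomposition with it is a bijection on
homotopy classes of maps into absolute neighbourhood retracts. -/
theorem isShapeEquivalence_of_bijective {X Y : Type u} [TopologicalSpace X] [TopologicalSpace Y]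
    (f : C(X, Y)) (hf : ∀ (P : Type u) [TopologicalSpace P], IsANR P →
      Function.Bijective (HomotopyClasses.precomp f : HomotopyClasses Y P → HomotopyClasses X P)) :
    IsShapeEquivalence f := by
  refine ⟨⟨fun P _ hP => (Equiv.ofBijective _ (hf P hP)).symm, fun P Q _ _ hP hQ g a => ?_⟩, ?_, ?_⟩
  · rw [Equiv.symm_apply_eq]
    obtain ⟨b, rfl⟩ := (hf P hP).surjective a
    rw [show HomotopyClasses.precomp f b = Equiv.ofBijective _ (hf P hP) b from rfl,
      Equiv.symm_apply_apply]
    exact ((ShapeMorphism.ofMap f).naturality P Q hP hQ g b).symm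
  · ext P _ hP a
    exact (Equiv.ofBijective _ (hf P hP)).apply_symm_apply a
  · ext P _ hP a
    exact (Equiv.ofBijective _ (hf P hP)).symm_apply_apply a

/-- A compact subset of a compact metric space into each neighbourhood of which the whole space
deforms relative to the subset is included by a shape equivalence. -/
theorem isShapeEquivalence_subtype_val_of_deformation {N : Type u} [MetricSpace N] [CompactSpace N]
    {K : Set N} (hK : IsCompact K)
    (hdef : ∀ V : Set N, IsOpen V → K ⊆ V → ∃ H : I × N → N, Continuous H ∧
      (∀ x, H (0, x) = x) ∧ (∀ t, ∀ x ∈ K, H (t, x) = x) ∧ ∀ x, H (1, x) ∈ V) :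
    IsShapeEquivalence (⟨Subtype.val, continuous_subtype_val⟩ : C(↥K, N)) := by
  classical
  refine isShapeEquivalence_of_bijective _ fun P _ hP => ⟨?_, ?_⟩
  · rintro ⟨f⟩ ⟨g⟩ hfg
    obtain ⟨F⟩ := Quotient.exact hfg
    refine Quotient.sound ?_
    -- The final `f p.2` is a junk value: only the restriction of `φ` to `{0, 1} × N ∪ I × K`
    -- matters.
    let φ : I × N → P := fun p => if p.1 = 0 then f p.2 else if p.1 = 1 then g p.2 else
      if hp : p.2 ∈ K then F (p.1, ⟨p.2, hp⟩) else f p.2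
    have hφ0 : ∀ x, φ (0, x) = f x := fun x => if_pos rfl
    have hφ1 : ∀ x, φ (1, x) = g x := fun x => by simp [φ]
    have hφK : ∀ t (x : K), φ (t, x) = F (t, x) := fun t x => by
      by_cases h0 : t = 0
      · subst h0; rw [hφ0, F.apply_zero]; rfl
      by_cases h1 : t = 1
      · subst h1; rw [hφ1, F.apply_one]; rfl
      simp [φ, h0, h1]
    have hc0 : IsClosed (({0} : Set I) ×ˢ (univ : Set N)) := isClosed_singleton.prod isClosed_univ
    have hc1 : IsClosed (({1} : Set I) ×ˢ (univ : Set N)) := isClosed_singleton.prod isClosed_univ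
    have hcK : IsClosed ((univ : Set I) ×ˢ K) := isClosed_univ.prod hK.isClosed
    have hφ : ContinuousOn φ (({0} ×ˢ univ ∪ {1} ×ˢ univ) ∪ univ ×ˢ K) := by
      refine ContinuousOn.union_of_isClosed (ContinuousOn.union_of_isClosed ?_ ?_ hc0 hc1) ?_
        (hc0.union hc1) hcK
      · refine (f.continuous.comp continuous_snd).continuousOn.congr ?_
        rintro ⟨t, x⟩ ⟨rfl, -⟩
        exact hφ0 x
      · refine (g.continuous.comp continuous_snd).continuousOn.congr ?_
        rintro ⟨t, x⟩ ⟨rfl, -⟩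
        exact hφ1 x
      · rw [continuousOn_iff_continuous_domRestrict]
        have : Continuous fun p : ↥((univ : Set I) ×ˢ K) => F (p.1.1, ⟨p.1.2, p.2.2⟩) := by fun_prop
        exact this.congr fun p => (hφK p.1.1 ⟨p.1.2, p.2.2⟩).symm
    obtain ⟨U, hU, hAU, ψ, hψ, hψφ⟩ := hP.exists_extension
      ((hc0.union hc1).union hcK).isCompact hφ
    obtain ⟨V₁, V, -, hV, hV₁, hKV, hVU⟩ := generalized_tube_lemma (isCompact_univ (X := I)) hK hU
      (subset_union_right.trans hAU)
    obtain ⟨H, hH, hH0, -, hH1⟩ := hdef V hV hKV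
    have hmem : ∀ t x, (t, H (1, x)) ∈ U := fun t x => hVU ⟨hV₁ (mem_univ t), hH1 x⟩
    have hdeform : ∀ k : C(N, P), k.Homotopic (k.comp ⟨fun x => H (1, x), by fun_prop⟩) :=
      fun k => ⟨⟨⟨fun p => k (H p), by fun_prop⟩, fun x => by simp [hH0], fun x => rfl⟩⟩
    -- With `H₁ = H (1, ·)`, the chain is `f ≃ f ∘ H₁ ≃ g ∘ H₁ ≃ g`, the middle homotopy being `ψ
    -- (t, H₁ x)`.
    refine (hdeform f).trans (ContinuousMap.Homotopic.trans ?_ (hdeform g).symm)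
    refine ⟨⟨⟨fun p => ψ (p.1, H (1, p.2)), ?_⟩, fun x => ?_, fun x => ?_⟩⟩
    · exact hψ.comp_continuous (by fun_prop) fun p => hmem p.1 p.2
    · exact (hψφ (Or.inl (Or.inl ⟨mem_singleton _, mem_univ _⟩))).trans (hφ0 _)
    · exact (hψφ (Or.inl (Or.inr ⟨mem_singleton _, mem_univ _⟩))).trans (hφ1 _)
  · rintro ⟨f⟩
    obtain ⟨φ, hφ⟩ : ∃ φ : N → P, ∀ x : K, φ x = f x := by
      -- A value off `K` is needed. If `K` is empty, deforming `N` into `∅` shows that `N` is empty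
      -- too.
      rcases isEmpty_or_nonempty K with hKe | ⟨⟨x₀⟩⟩
      · obtain ⟨H, -, -, -, hH1⟩ := hdef ∅ isOpen_empty (isEmpty_coe_sort.1 hKe).subset
        exact ⟨fun x => (hH1 x).elim, fun x => hKe.elim x⟩
      · exact ⟨fun x => if hx : x ∈ K then f ⟨x, hx⟩ else f x₀, fun x => dif_pos x.2⟩
    have hφc : ContinuousOn φ K := by
      rw [continuousOn_iff_continuous_domRestrict]
      exact f.continuous.congr fun x => (hφ x).symm
    obtain ⟨V, hV, hKV, ψ, hψ, hψφ⟩ := hP.exists_extension hK hφc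
    obtain ⟨H, hH, -, hHK, hH1⟩ := hdef V hV hKV
    refine ⟨Quotient.mk _ ⟨fun x => ψ (H (1, x)), hψ.comp_continuous (by fun_prop) hH1⟩,
      congrArg (Quotient.mk _) (ContinuousMap.ext fun x => ?_)⟩
    change ψ (H (1, x)) = f x
    rw [hHK 1 x x.2, hψφ x.2, hφ]

theorem isOpen_manifoldInterior (n : ℕ) (N : Type u) [TopologicalSpace N] :
    IsOpen (manifoldInterior n N) :=
  isOpen_iff_mem_nhds.2 fun _ ⟨φ, hx⟩ =>
    Filter.mem_of_superset (φ.open_source.mem_nhds hx) fun _ hy => ⟨φ, hy⟩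

end

/-- The inclusion of a topological spine of a compact manifold with boundary is a shape
equivalence. -/
theorem mainTheorem10 (n : ℕ) (N : Type u) [TopologicalSpace N] [CompactSpace N]
    (hN : IsManifoldWithBoundary n N) (K : Set N) (hK : IsTopologicalSpine n K) :
    IsShapeEquivalence (⟨Subtype.val, continuous_subtype_val⟩ : C(↥K, N)) := by
  have := hN.t2
  have := hN.secondCountable
  let _ : MetricSpace N := TopologicalSpace.metrizableSpaceMetric N
  have : CompactSpace (manifoldBoundary n N) :=
    isCompact_iff_compactSpace.1 (isOpen_manifoldInterior n N).isClosed_compl.isCompact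
  obtain ⟨h⟩ := hK.homeomorphic
  exact isShapeEquivalence_subtype_val_of_deformation hK.isCompact fun V hV hKV =>
    exists_deformation_into_nhds hK.isCompact h hV hKV
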